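/- \textbf{Conventions.} $\overline{\mathbb R}=\mathbb R\cup\{\pm\infty\}$, where $-\infty$ is absorbing for addition and $a-b$ means $a+(-b)$; $\mathbb R_{\max}=\mathbb R\cup\{-\infty\}$. Let $X$ be a Hausdorff topological space and $Y$ a Polish space. Let $b:X\times Y\to\mathbb R_{\max}$ be lower semicontinuous (l.s.c.) in the second variable, such that for every $x$ there is $y$ with $b(x,y)\in\mathbb R$ and for every $y$ there is $x$ with $b(x,y)\in\mathbb R$. For $g:X\to\overline{\mathbb R}$ put $$B^\circ g(y)=\sup_{x\in X}\bigl(b(x,y)-g(x)\bigr),$$ $$\partial^\circ g(x)=\{y\in Y: b(x,y)\in\mathbb R,\ b(x',y)-g(x')\le b(x,y)-g(x)\ \forall x'\in X\},$$ and $(\partial^\circ g)^{-1}(y)=\{x\in X: y\in\partial^\circ g(x)\}$. For $h:Z\to\overline{\mathbb R}$ on a topological space $Z$, let $\operatorname{ldom}h=\{h<+\infty\}$, $\operatorname{dom}h=\{-\infty<h<+\infty\}$ and $\operatorname{idom}h=\{z\in\operatorname{dom}h:\limsup_{z'\to z}h(z')<+\infty\}$; $h$ is quasi-continuous if $h^{-1}(G)$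 is included in the closure of its interior for every open $G\subset\overline{\mathbb R}$, and quasi-continuous on its domain if its restriction to $\operatorname{dom}h$, with the induced topology, is so. A family $\{\Phi(z)\}_{z\in I}$ of subsets of a set is a covering of $W$ if $W\subset\bigcup_{z\in I}\Phi(z)$; then $y\in I$ is algebraically essential if $W\not\subset\bigcup_{z\in I\setminus\{y\}}\Phi(z)$, and (when $I$ is a topological space) topologically essential if $W\not\subset\bigcup_{z\in I\setminus U}\Phi(z)$ for all open neighbourhoods $U$ of $y$ in $I$. The covering is topologically minimal if all elements of $I$ are topologically essential. For $x\in X$ and $V\subset X$ put $b_{x,V}(y)=\sup_{z\in V}b(z,y)-b(x,y)$. The kernel $b$ is coercive if for all $x$ and all neighbourhoods $V$ of $x$ the sets $\{b_{x,V}\le\beta\}$, $\beta\in\mathbb R$, are relatively compact; it is upper coercive if for all $x$ and all neighbourhoods $V$ of $x$ there is a finite $W\subset V$ such that $b(x,\cdot)$ is bounded above by a real constant on each set $\{b_{x,W}\le\beta\}$, $\beta\in\mathbb R$. Let $\mathscr F_c$ be the set of l.s.c. functions $f:Y\to\overline{\mathbb R}$ such that $\{y: b(x,y)-f(y)\ge\beta\}$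 is relatively compact for all $x\in X$, $\beta\in\mathbb R$. Let $\mathscr C_b(Y)$ be the set of continuous functions $Y\to\mathbb R_{\max}$ that are bounded above by a real constant. $\mathscr{QL}(\mathscr C_b(Y))$ is the set of maps $F:\mathscr C_b(Y)\to\mathbb R_{\max}$ that are isotone, satisfy $F(\lambda+\varphi)=\lambda+F(\varphi)$ for $\lambda\in\mathbb R_{\max}$, satisfy for some $\alpha\in\mathbb R_{\max}$ $$F(\varphi\vee\psi)\le\alpha+\bigl(F(\varphi)\vee F(\psi)\bigr)\qquad\text{for all }\varphi,\psi\in\mathscr C_b(Y),\tag{1}$$ and satisfy $F(\varphi_n)\to F(\varphi)$ whenever $(\varphi_n)$ is a nondecreasing sequence of $\mathscr C_b(Y)$ converging pointwise to $\varphi\in\mathscr C_b(Y)$. $\rho(F)$ is the infimum of the $\alpha\in\mathbb R_{\max}$ satisfying (1), and $\mathscr L(\mathscr C_b(Y))=\{F\in\mathscr{QL}(\mathscr C_b(Y)):\rho(F)\le0\}$. A form $F\in\mathscr{QL}(\mathscr C_b(Y))$ is extended by $F(\varphi)=\sup\{F(\psi):\psi\in\mathscr C_b(Y),\psi\le\varphi\}$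 for l.s.c. $\varphi:Y\to\mathbb R_{\max}$, and then by $F(\varphi)=\inf\{F(\psi):\psi:Y\to\mathbb R_{\max}\text{ l.s.c.},\psi\ge\varphi\}$ for arbitrary $\varphi:Y\to\mathbb R_{\max}$; for $A\subset Y$, $F(A)=F(\mathbf 1_A)$ with $\mathbf 1_A=0$ on $A$ and $-\infty$ elsewhere. A density of $F$ is a map $f:Y\to\overline{\mathbb R}$ with $F(\varphi)=\sup_{y}(\varphi(y)-f(y))$ for all $\varphi\in\mathscr C_b(Y)$. A sequence $F_n$ converges weakly to $F$ if $F_n(\varphi)\to F(\varphi)$ for all $\varphi\in\mathscr C_b(Y)$; accumulation points for the weak convergence are those in $\mathscr{QL}(\mathscr C_b(Y))$ with the topology of pointwise convergence on $\mathscr C_b(Y)$. The sequence is asymptotically tight if $\limsup_n\rho(F_n)<+\infty$ and $\inf_{K\subset Y\text{ compact}}\limsup_nF_n(K^c)=-\infty$. \textbf{Theorem.} Let $(F_n)_{n\in\mathbb N}$ be an asymptotically tight sequence of $\mathscr{QL}(\mathscr C_b(Y))$ such that $\limsup_nF_n(Y)<+\infty$ and $\lim_n\rho(F_n)=0$. Let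 $g(x)=\limsup_nF_n(b(x,\cdot))$ for $x\in X$, and let $\overline F(\varphi)=\sup_{y\in Y}(\varphi(y)-B^\circ g(y))$ for all $\varphi:Y\to\mathbb R_{\max}$, and $\overline F(A)=\overline F(\mathbf 1_A)$ for $A\subset Y$. Assume that \begin{itemize} \item either $Y$ is discrete, or $b$ is continuous in the second variable and $B^\circ g(y)>-\infty$ for all $y\in Y$; \item either $B^\circ g\in\mathscr F_c$, or $b$ is coercive; \item $b$ is upper coercive, and $B^\circ g$ is quasi-continuous on its domain. \end{itemize} Then: \begin{enumerate} \item[(i)] There exist $F\in\mathscr L(\mathscr C_b(Y))$ and a subsequence of $(F_n)$ which converges weakly to $F$. \item[(ii)] $\{(\partial^\circ g)^{-1}(y)\}_{y\in\operatorname{ldom}B^\circ g}$ is a covering of $\operatorname{idom}g$. \item[(iii)] If $F$ is an accumulation point of $(F_n)$ for the weak convergence, then $F\in\mathscr L(\mathscr C_b(Y))$, $F$ has a unique l.s.c. density $f$, and $f\ge B^\circ g$. Moreover $\limsup_nF_n(C)\le\overline F(C)$ for all closed $C\subset Y$. \end{enumerate} Assume in addition that $g(x)=\lim_nF_n(b(x,\cdot))$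 for all $x\in X$. Let $Z=Z_a\cup\operatorname{int}Z_t$, where $Z_a$ (resp. $Z_t$) is the set of algebraically (resp. topologically) essential elements with respect to the covering in (ii), and $\operatorname{int}$ denotes the interior relatively to $\operatorname{dom}B^\circ g$. Then: \begin{enumerate} \item[(iv)] If $F$ and $f$ are as in (iii), then $f=B^\circ g$ on $Z$. Moreover $\liminf_nF_n(G)\ge\overline F(G\cap Z)$ for all open $G\subset Y$. \item[(v)] If the covering in (ii) is topologically minimal, then $\overline F\in\mathscr L(\mathscr C_b(Y))$ and $F_n$ converges weakly to $\overline F$. \end{enumerate} -/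

import Mathlib

open Filter Topology Set

namespace MaxPlus

noncomputable section

/-! The extended reals are `EReal`.  In Mathlib `⊥ + ⊤ = ⊤ + ⊥ = ⊥` and `a - b = a + (-b)`, so that
`-∞` is absorbing for the addition. The semiring `ℝ ∪ {-∞}` is the set of the elements of `EReal`
that differ from `⊤`. -/

section Conjugacy

variable {X Y : Type*}

/-- The dual Moreau conjugacy: `B° g (y) = sup_x (b(x,y) - g(x))`. -/
def Bcirc (b : X → Y → EReal) (g : X → EReal) : Y → EReal :=
  fun y => ⨆ x, (b x y - g x)

/-- The subdifferential `∂° g (x)` of `g` at `x` with respect to the kernel `(y, x) ↦ b x y`. -/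
def subdiffCirc (b : X → Y → EReal) (g : X → EReal) (x : X) : Set Y :=
  {y | (b x y ≠ ⊥ ∧ b x y ≠ ⊤) ∧ ∀ x', b x' y - g x' ≤ b x y - g x}

/-- The inverse subdifferential `(∂° g)⁻¹(y) = {x | y ∈ ∂° g (x)}`. -/
def invSubdiffCirc (b : X → Y → EReal) (g : X → EReal) (y : Y) : Set X :=
  {x | y ∈ subdiffCirc b g x}

/-- The set where `h < +∞`. -/
def lowerDom {Z : Type*} (h : Z → EReal) : Set Z := {z | h z < ⊤}

/-- The set where `h > -∞`. -/
def upperDom {Z : Type*} (h : Z → EReal) : Set Z := {z | ⊥ < h z}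

/-- The domain of `h`, that is the set where `h` is finite. -/
def dom {Z : Type*} (h : Z → EReal) : Set Z := lowerDom h ∩ upperDom h

/-- The set of the points `z` of the domain of `h` with `limsup_{z' → z} h(z') < +∞`. -/
def idom {Z : Type*} [TopologicalSpace Z] (h : Z → EReal) : Set Z :=
  {z ∈ dom h | limsup h (𝓝 z) < ⊤}

/-- `b_{x,V}(y) = sup_{z ∈ V} (b(z,y) - b(x,y))`. -/
def excess (b : X → Y → EReal) (x : X) (V : Set X) (y : Y) : EReal :=
  ⨆ z ∈ V, (b z y - b x y)

/-- `b` is coercive: all the functions `b_{x,V}`, with `V` a neighbourhood of `x`, have relatively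
compact finite sublevel sets. -/
def Coercive [TopologicalSpace X] [TopologicalSpace Y] (b : X → Y → EReal) : Prop :=
  ∀ x, ∀ V ∈ 𝓝 x, ∀ β : ℝ, IsCompact (closure {y | excess b x V y ≤ (β : EReal)})

/-- `b` is upper coercive: each neighbourhood `V` of each `x` has a finite subset `W` such that
`b(x,·)` is bounded above on each finite sublevel set of `b_{x,W}`. -/
def UpperCoercive [TopologicalSpace X] (b : X → Y → EReal) : Prop :=
  ∀ x, ∀ V ∈ 𝓝 x, ∃ W : Set X, W.Finite ∧ W ⊆ V ∧
    ∀ β : ℝ, ∃ M : ℝ, ∀ y, excess b x W y ≤ (β : EReal) → b x y ≤ (M : EReal)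

/-- The class `ℱ_c` of the l.s.c. functions `f` such that, for all `x`, the function `b(x,·) - f`
has relatively compact finite superlevel sets. -/
def classFc [TopologicalSpace Y] (b : X → Y → EReal) : Set (Y → EReal) :=
  {f | LowerSemicontinuous f ∧
    ∀ x, ∀ β : ℝ, IsCompact (closure {y | (β : EReal) ≤ b x y - f y})}

/-- Quasi-continuity: the inverse image of an open set lies in the closure of its interior. -/
def QuasiContinuous {Z : Type*} [TopologicalSpace Z] (h : Z → EReal) : Prop :=
  ∀ G : Set EReal, IsOpen G → h ⁻¹' G ⊆ closure (interior (h ⁻¹' G))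

/-- Quasi-continuity of the restriction of `h` to its domain (with the induced topology). -/
def QuasiContinuousOnDom {Z : Type*} [TopologicalSpace Z] (h : Z → EReal) : Prop :=
  QuasiContinuous (fun z : dom h => h z)

/-- Standing assumptions on the kernel: values in `ℝ ∪ {-∞}`, lower semicontinuity in the second
variable, and no row and no column is identically `-∞`. -/
structure IsKernel [TopologicalSpace Y] (b : X → Y → EReal) : Prop where
  ne_top : ∀ x y, b x y ≠ ⊤
  lsc : ∀ x, LowerSemicontinuous (b x)
  exists_right : ∀ x, ∃ y, b x y ≠ ⊥
  exists_left : ∀ y, ∃ x, b x y ≠ ⊥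

/-- The technical assumption on `b` and `g`. -/
structure TechnicalAssumption [TopologicalSpace X] [TopologicalSpace Y]
    (b : X → Y → EReal) (g : X → EReal) : Prop where
  discrete_or_continuous :
    DiscreteTopology Y ∨ ((∀ x, Continuous (b x)) ∧ ∀ y, ⊥ < Bcirc b g y)
  compactness : Bcirc b g ∈ classFc b ∨ Coercive b
  upperCoercive : UpperCoercive b
  quasiContinuous : QuasiContinuousOnDom (Bcirc b g)

end Conjugacy

section Covering

variable {I W : Type*}

/-- The family `{Φ z}_{z ∈ I'}` is a covering of `W'`. -/
def IsCovering (Φ : I → Set W) (I' : Set I) (W' : Set W) : Prop :=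
  W' ⊆ ⋃ z ∈ I', Φ z

/-- `y` is algebraically essential with respect to the covering of `W'` by `{Φ z}_{z ∈ I'}`. -/
def AlgEssential (Φ : I → Set W) (I' : Set I) (W' : Set W) (y : I) : Prop :=
  y ∈ I' ∧ ¬ W' ⊆ ⋃ z ∈ I' \ {y}, Φ z

/-- `y` is topologically essential with respect to the covering of `W'` by `{Φ z}_{z ∈ I'}`.
The open neighbourhoods of `y` in `I'` are the sets `U ∩ I'` with `U` open and `y ∈ U`. -/
def TopEssential [TopologicalSpace I] (Φ : I → Set W) (I' : Set I) (W' : Set W) (y : I) : Prop :=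
  y ∈ I' ∧ ∀ U : Set I, IsOpen U → y ∈ U → ¬ W' ⊆ ⋃ z ∈ I' \ U, Φ z

/-- `{Φ z}_{z ∈ I'}` is a topologically minimal covering of `W'`. -/
def IsTopMinimalCovering [TopologicalSpace I] (Φ : I → Set W) (I' : Set I) (W' : Set W) : Prop :=
  IsCovering Φ I' W' ∧ ∀ y ∈ I', TopEssential Φ I' W' y

/-- The interior of `S` relatively to `D`. -/
def relInterior [TopologicalSpace I] (D S : Set I) : Set I :=
  {y ∈ D | ∃ U : Set I, IsOpen U ∧ y ∈ U ∧ U ∩ D ⊆ S}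

/-- The set `Z = Z_a ∪ int(Z_t)`, where `Z_a` and `Z_t` are the sets of algebraically and of
topologically essential elements with respect to the covering of `X' ∩ {g > -∞}` by the sets
`(∂° g)⁻¹(y)`, `B° g (y) < +∞`, and the interior is relative to the domain of `B° g`. -/
def essentialSet {X Y : Type*} [TopologicalSpace Y] (b : X → Y → EReal) (g : X → EReal)
    (X' : Set X) : Set Y :=
  {y | AlgEssential (invSubdiffCirc b g) (lowerDom (Bcirc b g)) (X' ∩ upperDom g) y} ∪
    relInterior (dom (Bcirc b g))
      {y | TopEssential (invSubdiffCirc b g) (lowerDom (Bcirc b g)) (X' ∩ upperDom g) y}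

end Covering

section QuasiLinear

variable {Y : Type*}

/-- `C_b(Y)`: the continuous functions from `Y` to `ℝ ∪ {-∞}` that are bounded above. -/
def Cb (Y : Type*) [TopologicalSpace Y] : Set (Y → EReal) :=
  {φ | Continuous φ ∧ ∃ c : ℝ, ∀ y, φ y ≤ (c : EReal)}

/-- `lsc(Y)`: the l.s.c. functions from `Y` to `ℝ ∪ {-∞}`. -/
def lscFun (Y : Type*) [TopologicalSpace Y] : Set (Y → EReal) :=
  {φ | LowerSemicontinuous φ ∧ ∀ y, φ y ≠ ⊤}

/-- The defining inequality, with constant `α`, of quasi-linear forms on `M`. -/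
def SubMax (M : Set (Y → EReal)) (F : (Y → EReal) → EReal) (α : EReal) : Prop :=
  ∀ φ ∈ M, ∀ ψ ∈ M, F (φ ⊔ ψ) ≤ α + (F φ ⊔ F ψ)

/-- `F` is a quasi- (max-plus) -linear form on `M`. A form on `M` is given as a map on all functions
of which only the values on `M` are ever used. -/
structure IsQuasiLinear (M : Set (Y → EReal)) (F : (Y → EReal) → EReal) : Prop where
  isotone : MonotoneOn F M
  homogeneous : ∀ c : EReal, c ≠ ⊤ → ∀ φ ∈ M, F (fun y => c + φ y) = c + F φ
  subMax : ∃ α : EReal, α ≠ ⊤ ∧ SubMax M F α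

/-- `F` preserves the nondecreasing sequences of `M` that converge (pointwise) in `M`. -/
def SeqContinuousOn (M : Set (Y → EReal)) (F : (Y → EReal) → EReal) : Prop :=
  ∀ (φ : ℕ → Y → EReal) (ψ : Y → EReal), (∀ n, φ n ∈ M) → ψ ∈ M → Monotone φ →
    (∀ y, Tendsto (fun n => φ n y) atTop (𝓝 (ψ y))) →
    Tendsto (fun n => F (φ n)) atTop (𝓝 (F ψ))

/-- `ρ(F)`: the infimum of the constants `α` in the inequality of quasi-linear forms. -/
def rho (M : Set (Y → EReal)) (F : (Y → EReal) → EReal) : EReal :=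
  sInf {α | α ≠ ⊤ ∧ SubMax M F α}

/-- `𝒬ℒ(M)`: the continuous quasi-linear forms from `M` to `ℝ ∪ {-∞}`. -/
def QL (M : Set (Y → EReal)) : Set ((Y → EReal) → EReal) :=
  {F | IsQuasiLinear M F ∧ SeqContinuousOn M F ∧ ∀ φ ∈ M, F φ ≠ ⊤}

/-- `ℒ(M)`: the elements of `𝒬ℒ(M)` that are max-plus linear, that is with `ρ(F) ≤ 0`. -/
def LinForm (M : Set (Y → EReal)) : Set ((Y → EReal) → EReal) :=
  {F | F ∈ QL M ∧ rho M F ≤ 0}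

/-- The max-plus linear form with density `f`: `φ ↦ sup_y (φ(y) - f(y))`. -/
def densityForm (f : Y → EReal) (φ : Y → EReal) : EReal := ⨆ y, (φ y - f y)

open Classical in
/-- The max-plus characteristic function of `A`: `0` on `A` and `-∞` elsewhere. -/
def ind (A : Set Y) : Y → EReal := fun y => if y ∈ A then 0 else ⊥

variable [TopologicalSpace Y]

/-- `f` is a l.s.c. density of the form `F` on `C_b(Y)`. -/
def IsLscDensity (f : Y → EReal) (F : (Y → EReal) → EReal) : Prop :=
  LowerSemicontinuous f ∧ ∀ φ ∈ Cb Y, F φ = densityForm f φ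

/-- Extension of a form on `C_b(Y)` to `lsc(Y)`. -/
def extLsc (F : (Y → EReal) → EReal) (φ : Y → EReal) : EReal :=
  ⨆ ψ ∈ {ψ ∈ Cb Y | ψ ≤ φ}, F ψ

/-- Maximal extension of a form on `C_b(Y)` to all functions from `Y` to `ℝ ∪ {-∞}`. -/
def maxExt (F : (Y → EReal) → EReal) (φ : Y → EReal) : EReal :=
  ⨅ ψ ∈ {ψ ∈ lscFun Y | φ ≤ ψ}, extLsc F ψ

/-- The value `F(A)` of (the maximal extension of) a form on `C_b(Y)` on a subset `A` of `Y`. -/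
def setValue (F : (Y → EReal) → EReal) (A : Set Y) : EReal := maxExt F (ind A)

/-- Weak convergence of a sequence of forms on `C_b(Y)`. -/
def WeaklyConverges (F : ℕ → (Y → EReal) → EReal) (F' : (Y → EReal) → EReal) : Prop :=
  ∀ φ ∈ Cb Y, Tendsto (fun n => F n φ) atTop (𝓝 (F' φ))

/-- `F'` is an accumulation point of the sequence `F`, in `𝒬ℒ(C_b(Y))` with the topology of weak
convergence, that is of pointwise convergence on `C_b(Y)`. -/
def IsWeakAccPt (F : ℕ → (Y → EReal) → EReal) (F' : (Y → EReal) → EReal) : Prop :=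
  F' ∈ QL (Cb Y) ∧
    MapClusterPt (fun φ : Cb Y => F' φ) atTop (fun n => fun φ : Cb Y => F n φ)

/-- Asymptotic tightness of a sequence of forms on `C_b(Y)`. -/
def AsymptoticallyTight (F : ℕ → (Y → EReal) → EReal) : Prop :=
  limsup (fun n => rho (Cb Y) (F n)) atTop < ⊤ ∧
    (⨅ K ∈ {K : Set Y | IsCompact K}, limsup (fun n => setValue (F n) Kᶜ) atTop) = ⊥

end QuasiLinear

end

end MaxPlus

open MaxPlus

/-!
The theorem is a large deviation principle for max-plus forms, and its proof is the max-plus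
counterpart of Prokhorov's theorem followed by an identification of the limits.

The upper limit `upperForm F l` of the forms along a filter `l` of indices is monotone, commutes
with the addition of constants and, because the defects `rho` tend to zero, preserves finite suprema of
lower semicontinuous functions. Tightness turns this into a compactness principle
(`TightAlong.exists_majorant`): a function that locally has majorants of upper limit at most `M` has
a global one. Hence, if the values on a basis of open sets converge along `l`, then the forms
converge weakly to a form with a lower semicontinuous density (`TightAlong.exists_density`). A countable
basis gives a convergent subsequence, and along an ultrafilter convergence is automatic; the latter
describes all the accumulation points, and is used in place of subsequences everywhere else.

Comparing characteristic functions of small open sets with the functions `b x` bounds the upper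
limit near `y` by `-B° g y` (`TightAlong.exists_open_upperForm_le`). By the compactness principle
this gives the bound on closed sets, and it shows that each limit density `f` is at least `B° g`.

For the reverse inequality, let `x ∈ idom g`. Upper coercivity shows that the mass of the unbounded
function `b x` does not escape (`TightAlong.le_iSup_sub`), so `g x ≤ sup_y (b x y - f y)`
if the ultrafilter realizes `g x`. The supremum is attained by compactness, and at a maximizer `y`
one has `f y = B° g y` and `y ∈ ∂° g (x)` (`exists_subgradient`). This is the covering property.
It also gives contact of `f` and `B° g` on the essential set: directly at an algebraically essential
point, by quasi-continuity in the interior of the set of topologically essential points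
(`eq_Bcirc_on_essentialSet`). If every point is topologically essential, `f = B° g` for all limits.
-/

namespace MaxPlus

/-! ### Arithmetic of the extended reals -/

/-- The two subtracted terms can be exchanged without any finiteness assumption, thanks to the
convention `⊤ - ⊤ = ⊥ - ⊥ = ⊥`. -/
theorem sub_le_of_sub_le {a b c : EReal} (h : a - b ≤ c) : a - c ≤ b := by
  induction a with
  | bot => simp [sub_eq_add_neg]
  | top => induction b <;> induction c <;> simp_all [sub_eq_add_neg]
  | coe a =>
    by_cases hb : b = ⊤
    · simp [hb]
    by_cases hc : c = ⊤
    · simp [hc]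
    rw [EReal.sub_le_iff_le_add (.inr hc) (.inl hb)] at h
    exact EReal.sub_le_of_le_add' h

theorem coe_add_le_iff {c : ℝ} {a b : EReal} :
    (c : EReal) + a ≤ b ↔ a ≤ ((-c : ℝ) : EReal) + b := by
  induction a <;> induction b <;> simp
  · norm_cast
    constructor <;> intro h <;> linarith
  · exact EReal.coe_ne_top (-c + _)

theorem continuous_coe_add (c : ℝ) : Continuous (fun a : EReal => (c : EReal) + a) :=
  continuous_iff_continuousAt.2 fun a =>
    (EReal.continuousAt_add (p := ((c : EReal), a)) (by simp) (by simp)).comp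
      (f := fun a : EReal => ((c : EReal), a)) (by fun_prop)

/-- The real number `c` separates `p` from `M - a`, including when `a` or `p` is `⊥`. -/
theorem exists_coe_of_add_lt {p a : EReal} {M : ℝ} (hp : p < ⊤) (ha : a < ⊤) (h : p + a < M) :
    ∃ c : ℝ, p < c ∧ (c : EReal) + a ≤ M := by
  induction a with
  | top => exact absurd ha (lt_irrefl _)
  | bot =>
    obtain ⟨c, hc, -⟩ := EReal.lt_iff_exists_real_btwn.1 hp
    exact ⟨c, hc, by simp⟩
  | coe a =>
    refine ⟨M - a, ?_, by rw [← EReal.coe_add]; simp⟩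
    induction p with
    | bot => exact EReal.bot_lt_coe _
    | top => exact absurd hp (lt_irrefl _)
    | coe p =>
      norm_cast at h ⊢
      linarith

theorem le_of_forall_coe_add_le {r : ℝ} {a L : EReal} (h : ∀ c : ℝ, c < r → (c : EReal) + a ≤ L) :
    (r : EReal) + a ≤ L := by
  refine EReal.add_le_of_forall_lt fun a' ha' b' hb' => ?_
  obtain ⟨c, hc, hc'⟩ := EReal.lt_iff_exists_real_btwn.1 ha'
  exact (add_le_add hc.le hb'.le).trans (h c (by exact_mod_cast hc'))

theorem le_of_forall_le_pos_add {a b : EReal} (h : ∀ ε : ℝ, 0 < ε → a ≤ ε + b) : a ≤ b := by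
  induction b with
  | top => exact le_top
  | bot => simpa using h 1 one_pos
  | coe b =>
    refine EReal.le_of_forall_lt_iff_le.1 fun z hz => ?_
    have := h (z - b) (by have : b < z := by exact_mod_cast hz
                          linarith)
    rwa [← EReal.coe_add, sub_add_cancel] at this

theorem exists_real_ge_of_lt_top {a : EReal} (h : a < ⊤) : ∃ c : ℝ, a ≤ c := by
  obtain ⟨c, hc, -⟩ := EReal.lt_iff_exists_real_btwn.1 h
  exact ⟨c, hc.le⟩

theorem eq_coe_of_ne {a : EReal} (h : a ≠ ⊥) (h' : a ≠ ⊤) : ∃ r : ℝ, a = r :=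
  ⟨a.toReal, (EReal.coe_toReal h' h).symm⟩

/-! ### Test functions and lower semicontinuous functions -/

section TestFunctions

variable {Y : Type*}

theorem ind_le_zero (A : Set Y) (y : Y) : ind A y ≤ 0 := by
  unfold ind; split_ifs <;> simp

theorem ind_of_mem {A : Set Y} {y : Y} (h : y ∈ A) : ind A y = 0 := if_pos h

theorem ind_of_notMem {A : Set Y} {y : Y} (h : y ∉ A) : ind A y = ⊥ := if_neg h

theorem ind_le_of_zero_le {A : Set Y} {φ : Y → EReal} (h : ∀ y ∈ A, 0 ≤ φ y) : ind A ≤ φ := by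
  intro y
  by_cases hy : y ∈ A
  · rw [ind_of_mem hy]; exact h y hy
  · rw [ind_of_notMem hy]; exact bot_le

variable [TopologicalSpace Y]

theorem const_mem_Cb {c : EReal} (hc : c ≠ ⊤) : (fun _ : Y => c) ∈ Cb Y :=
  ⟨continuous_const, (exists_real_ge_of_lt_top hc.lt_top).imp fun _ h _ => h⟩

theorem sup_mem_Cb {φ ψ : Y → EReal} (hφ : φ ∈ Cb Y) (hψ : ψ ∈ Cb Y) : φ ⊔ ψ ∈ Cb Y := by
  obtain ⟨h1, c, hc⟩ := hφ
  obtain ⟨h2, d, hd⟩ := hψ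
  refine ⟨h1.sup h2, max c d, fun y => ?_⟩
  exact sup_le ((hc y).trans (by simp)) ((hd y).trans (by simp))

theorem inf_mem_Cb {φ ψ : Y → EReal} (hφ : φ ∈ Cb Y) (hψ : Continuous ψ) : φ ⊓ ψ ∈ Cb Y := by
  obtain ⟨h1, c, hc⟩ := hφ
  exact ⟨h1.inf hψ, c, fun y => inf_le_left.trans (hc y)⟩

theorem coe_add_mem_Cb (c : ℝ) {φ : Y → EReal} (hφ : φ ∈ Cb Y) :
    (fun y => (c : EReal) + φ y) ∈ Cb Y := by
  obtain ⟨h1, d, hd⟩ := hφ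
  refine ⟨(continuous_coe_add c).comp h1, c + d, fun y => ?_⟩
  rw [EReal.coe_add]
  exact add_le_add_right (hd y) _

theorem Cb_subset_lscFun : Cb Y ⊆ lscFun Y := by
  rintro φ ⟨h1, c, hc⟩
  exact ⟨h1.lowerSemicontinuous, fun y => ((hc y).trans_lt (EReal.coe_lt_top c)).ne⟩

theorem sup_mem_lscFun {φ ψ : Y → EReal} (hφ : φ ∈ lscFun Y) (hψ : ψ ∈ lscFun Y) :
    φ ⊔ ψ ∈ lscFun Y :=
  ⟨hφ.1.sup hψ.1, fun y => (max_lt (hφ.2 y).lt_top (hψ.2 y).lt_top).ne⟩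

theorem coe_add_mem_lscFun (c : ℝ) {φ : Y → EReal} (hφ : φ ∈ lscFun Y) :
    (fun y => (c : EReal) + φ y) ∈ lscFun Y := by
  refine ⟨(continuous_coe_add c).comp_lowerSemicontinuous hφ.1
    fun a b h => add_le_add_right h _, fun y => ?_⟩
  exact (EReal.add_lt_top (EReal.coe_ne_top c) (hφ.2 y)).ne

theorem ind_mem_lscFun {U : Set Y} (hU : IsOpen U) : ind U ∈ lscFun Y := by
  refine ⟨fun y a ha => ?_, fun y => ((ind_le_zero U y).trans_lt EReal.zero_lt_top).ne⟩
  by_cases hy : y ∈ U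
  · filter_upwards [hU.mem_nhds hy] with z hz
    rwa [ind_of_mem hz, ← ind_of_mem hy]
  · have ha : a < ind U y := ha
    rw [ind_of_notMem hy] at ha
    exact absurd ha not_lt_bot

/-- The bumps `log (min 1 (n d(·, Uᶜ)))` exhaust the characteristic function of `U`, and
each point of `U` is eventually on their plateau. -/
theorem exists_bumps [TopologicalSpace.MetrizableSpace Y] {U : Set Y} (hU : IsOpen U) :
    ∃ χ : ℕ → Y → EReal, (∀ n, χ n ∈ Cb Y ∧ χ n ≤ ind U) ∧ ∀ y ∈ U, ∃ n, χ n y = 0 := by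
  let _ := TopologicalSpace.metrizableSpaceMetric Y
  have hle : ∀ (n : ℕ) (y : Y), ENNReal.log (min 1 (n * Metric.infEDist y Uᶜ)) ≤ 0 := fun n y =>
    ENNReal.log_le_zero_iff.2 (min_le_left _ _)
  refine ⟨fun n y => ENNReal.log (min 1 (n * Metric.infEDist y Uᶜ)), fun n => ⟨⟨?_, 0, ?_⟩, ?_⟩, ?_⟩
  · refine ENNReal.continuous_log.comp (continuous_const.min ?_)
    exact (ENNReal.continuous_const_mul (ENNReal.natCast_ne_top n)).comp Metric.continuous_infEDist
  · exact hle n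
  · intro y
    by_cases hy : y ∈ U
    · rw [ind_of_mem hy]; exact hle n y
    · have : Metric.infEDist y Uᶜ = 0 := Metric.infEDist_zero_of_mem hy
      simp [this]
  · intro y hy
    have h0 : Metric.infEDist y Uᶜ ≠ 0 := fun h =>
      (Metric.mem_iff_infEDist_zero_of_closed hU.isClosed_compl).2 h hy
    obtain ⟨n, hn⟩ := ENNReal.exists_nat_mul_gt h0 ENNReal.one_ne_top
    exact ⟨n, by simp [min_eq_left hn.le]⟩

theorem exists_bump [TopologicalSpace.MetrizableSpace Y] {U : Set Y} (hU : IsOpen U) {y : Y}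
    (hy : y ∈ U) : ∃ φ ∈ Cb Y, φ ≤ ind U ∧ φ y = 0 := by
  obtain ⟨χ, h1, h2⟩ := exists_bumps hU
  obtain ⟨n, hn⟩ := h2 y hy
  exact ⟨χ n, (h1 n).1, (h1 n).2, hn⟩

/-- A lower semicontinuous function `ψ` is the supremum of the countably many functions
`q + χ`, with `q` rational and `χ` one of the bumps below the characteristic function of
`{ψ > q}`. -/
theorem exists_monotone_seq_of_lowerSemicontinuous [TopologicalSpace.MetrizableSpace Y]
    {ψ : Y → EReal} (hψ : LowerSemicontinuous ψ) :
    ∃ χ : ℕ → Y → EReal, (∀ n, χ n ∈ Cb Y) ∧ Monotone χ ∧ ∀ y, ⨆ n, χ n y = ψ y := by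
  choose χ h1 h2 using fun q : ℚ => exists_bumps (hψ.isOpen_preimage ((q : ℝ) : EReal))
  obtain ⟨e, he⟩ := exists_surjective_nat (ℚ × ℕ)
  set θ : ℕ → Y → EReal := fun k y => (((e k).1 : ℝ) : EReal) + χ (e k).1 (e k).2 y
  have hθ : ∀ k, θ k ∈ Cb Y := fun k => coe_add_mem_Cb _ (h1 _ _).1
  refine ⟨partialSups θ, fun n => ?_, (partialSups θ).monotone, fun y => ?_⟩
  · induction n with
    | zero => simpa using hθ 0
    | succ n ih => simpa [partialSups_add_one] using sup_mem_Cb ih (hθ (n + 1))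
  · rw [← iSup_apply, iSup_partialSups_eq, iSup_apply]
    apply le_antisymm
    · refine iSup_le fun k => ?_
      by_cases hy : (((e k).1 : ℝ) : EReal) < ψ y
      · calc θ k y ≤ (((e k).1 : ℝ) : EReal) + 0 := by
              exact add_le_add_right (((h1 _ _).2 y).trans (ind_le_zero _ y)) _
          _ ≤ ψ y := by rw [add_zero]; exact hy.le
      · have : χ (e k).1 (e k).2 y = ⊥ := by
          have := (h1 (e k).1 (e k).2).2 y
          rwa [ind_of_notMem (by simpa using hy), le_bot_iff] at this
        simp [θ, this]
    · refine le_of_forall_lt fun a ha => ?_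
      obtain ⟨q, hq, hq'⟩ := EReal.lt_iff_exists_rat_btwn.1 ha
      obtain ⟨n, hn⟩ := h2 q y hq'
      obtain ⟨k, hk⟩ := he (q, n)
      refine hq.trans_le (le_iSup_of_le k ?_)
      simp [θ, hk, hn]

end TestFunctions
/-! ### The extension of a form to lower semicontinuous functions -/

section Extension

theorem SubMax.mono {Y : Type*} {M : Set (Y → EReal)} {F : (Y → EReal) → EReal} {α β : EReal}
    (h : SubMax M F α) (hαβ : α ≤ β) : SubMax M F β :=
  fun φ hφ ψ hψ => (h φ hφ ψ hψ).trans (add_le_add_left hαβ _)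

variable {Y : Type*} [TopologicalSpace Y] {F : (Y → EReal) → EReal}

theorem extLsc_mono {φ ψ : Y → EReal} (h : φ ≤ ψ) : extLsc F φ ≤ extLsc F ψ :=
  biSup_mono fun _ hχ => ⟨hχ.1, hχ.2.trans h⟩

theorem le_extLsc {φ ψ : Y → EReal} (hφ : φ ∈ Cb Y) (h : φ ≤ ψ) : F φ ≤ extLsc F ψ :=
  le_iSup₂_of_le φ ⟨hφ, h⟩ le_rfl

theorem extLsc_of_mem_Cb (hF : F ∈ QL (Cb Y)) {φ : Y → EReal} (hφ : φ ∈ Cb Y) :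
    extLsc F φ = F φ :=
  le_antisymm (iSup₂_le fun _ hχ => hF.1.isotone hχ.1 hφ hχ.2) (le_extLsc hφ le_rfl)

theorem maxExt_le {φ ψ : Y → EReal} (hψ : ψ ∈ lscFun Y) (h : φ ≤ ψ) : maxExt F φ ≤ extLsc F ψ :=
  iInf₂_le ψ ⟨hψ, h⟩

theorem maxExt_of_mem_lscFun {φ : Y → EReal} (hφ : φ ∈ lscFun Y) : maxExt F φ = extLsc F φ :=
  le_antisymm (maxExt_le hφ le_rfl) (le_iInf₂ fun _ hψ => extLsc_mono hψ.2)

theorem extLsc_coe_add_le (hF : F ∈ QL (Cb Y)) (c : ℝ) (φ : Y → EReal) :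
    extLsc F (fun y => (c : EReal) + φ y) ≤ c + extLsc F φ := by
  refine iSup₂_le fun χ hχ => ?_
  rw [← neg_neg c, ← coe_add_le_iff,
    ← hF.1.homogeneous _ (EReal.coe_ne_top _) χ hχ.1]
  refine le_extLsc (coe_add_mem_Cb _ hχ.1) fun y => ?_
  rw [coe_add_le_iff, neg_neg]
  exact hχ.2 y

theorem extLsc_bot (hF : F ∈ QL (Cb Y)) : extLsc F ⊥ = ⊥ := by
  have h := const_mem_Cb (Y := Y) bot_ne_top
  have := hF.1.homogeneous ⊥ bot_ne_top _ h
  simp only [EReal.bot_add] at this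
  exact (extLsc_of_mem_Cb hF h).trans this

/-- The quasi-linearity inequality passes to lower semicontinuous functions: approximate them
from below by test functions, and use the continuity of `F` along nondecreasing sequences. -/
theorem extLsc_sup_le [TopologicalSpace.MetrizableSpace Y] (hF : F ∈ QL (Cb Y)) {α : EReal}
    (hα : SubMax (Cb Y) F α) {φ ψ : Y → EReal} (hφ : LowerSemicontinuous φ)
    (hψ : LowerSemicontinuous ψ) :
    extLsc F (φ ⊔ ψ) ≤ α + (extLsc F φ ⊔ extLsc F ψ) := by
  obtain ⟨u, hu, hum, hus⟩ := exists_monotone_seq_of_lowerSemicontinuous hφ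
  obtain ⟨v, hv, hvm, hvs⟩ := exists_monotone_seq_of_lowerSemicontinuous hψ
  refine iSup₂_le fun χ hχ => ?_
  -- The truncations `χ ⊓ (u n ⊔ v n)` increase to `χ`, and each is below `u n ⊔ v n`.
  have hmem : ∀ n, χ ⊓ (u n ⊔ v n) ∈ Cb Y := fun n =>
    inf_mem_Cb hχ.1 ((hu n).1.sup (hv n).1)
  have hmon : Monotone fun n => χ ⊓ (u n ⊔ v n) := fun m n h =>
    inf_le_inf_left _ (sup_le_sup (hum h) (hvm h))
  have hlim : ∀ y, Tendsto (fun n => (χ ⊓ (u n ⊔ v n)) y) atTop (𝓝 (χ y)) := by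
    intro y
    have h : ⨆ n, (χ ⊓ (u n ⊔ v n)) y = χ y := by
      simp only [Pi.inf_apply, Pi.sup_apply]
      rw [← inf_iSup_eq, iSup_sup_eq, hus, hvs]
      exact inf_eq_left.2 (hχ.2 y)
    rw [← h]
    exact tendsto_atTop_iSup fun m n hmn => hmon hmn y
  refine le_of_tendsto (hF.2.1 _ χ hmem hχ.1 hmon hlim) (Eventually.of_forall fun n => ?_)
  calc F (χ ⊓ (u n ⊔ v n)) ≤ F (u n ⊔ v n) :=
        hF.1.isotone (hmem n) (sup_mem_Cb (hu n) (hv n)) inf_le_right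
    _ ≤ α + (F (u n) ⊔ F (v n)) := hα _ (hu n) _ (hv n)
    _ ≤ α + (extLsc F φ ⊔ extLsc F ψ) := by
        refine add_le_add_right (sup_le_sup (le_extLsc (hu n) fun y => ?_)
          (le_extLsc (hv n) fun y => ?_)) _
        · rw [← hus y]; exact le_iSup (fun n => u n y) n
        · rw [← hvs y]; exact le_iSup (fun n => v n y) n

end Extension

/-! ### The upper limit of a sequence of forms along a filter -/

section UpperForm

variable {Y : Type*} [TopologicalSpace Y]

/-- The upper limit along the filter `l` of a sequence of forms, as a functional on lower
semicontinuous functions. -/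
noncomputable def upperForm (F : ℕ → (Y → EReal) → EReal) (l : Filter ℕ) (φ : Y → EReal) : EReal :=
  limsup (fun n => extLsc (F n) φ) l

/-- The properties of a sequence of forms that the weak compactness argument uses, relative to a
filter on the indices. -/
structure TightAlong (F : ℕ → (Y → EReal) → EReal) (l : Filter ℕ) : Prop where
  mem : ∀ n, F n ∈ QL (Cb Y)
  subMax : ∀ ε : ℝ, 0 < ε → ∀ᶠ n in l, SubMax (Cb Y) (F n) ε
  tight : ∀ M : ℝ, ∃ K : Set Y, IsCompact K ∧ upperForm F l (ind Kᶜ) ≤ M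
  bdd : upperForm F l (ind univ) < ⊤

variable {F : ℕ → (Y → EReal) → EReal} {l l' : Filter ℕ}

theorem upperForm_mono {φ ψ : Y → EReal} (h : φ ≤ ψ) : upperForm F l φ ≤ upperForm F l ψ :=
  limsup_le_limsup (Eventually.of_forall fun _ => extLsc_mono h)

theorem upperForm_filter_mono (h : l ≤ l') (φ : Y → EReal) :
    upperForm F l φ ≤ upperForm F l' φ :=
  limsup_le_limsup_of_le h

theorem TightAlong.filter_mono (hF : TightAlong F l') (h : l ≤ l') : TightAlong F l where
  mem := hF.mem
  subMax ε hε := (hF.subMax ε hε).filter_mono h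
  tight M := (hF.tight M).imp fun _ hK => ⟨hK.1, (upperForm_filter_mono h _).trans hK.2⟩
  bdd := (upperForm_filter_mono h _).trans_lt hF.bdd

theorem TightAlong.upperForm_bot (hF : TightAlong F l) : upperForm F l ⊥ = ⊥ := by
  simp only [upperForm, fun n => extLsc_bot (hF.mem n)]
  exact limsup_const_bot

theorem TightAlong.upperForm_coe_add_le [l.NeBot] (hF : TightAlong F l) (c : ℝ) (φ : Y → EReal) :
    upperForm F l (fun y => (c : EReal) + φ y) ≤ c + upperForm F l φ := by
  have h1 : limsup (fun _ : ℕ => (c : EReal)) l = c := limsup_const _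
  calc upperForm F l (fun y => (c : EReal) + φ y)
      ≤ limsup ((fun _ : ℕ => (c : EReal)) + fun n => extLsc (F n) φ) l :=
        limsup_le_limsup (Eventually.of_forall fun n => extLsc_coe_add_le (hF.mem n) c φ)
    _ ≤ c + upperForm F l φ := by
        refine (EReal.limsup_add_le ?_ ?_).trans_eq (by rw [h1]; rfl) <;> simp [h1]

/-- Since the defects of the forms tend to zero, their upper limit preserves finite suprema. -/
theorem TightAlong.upperForm_sup_le [TopologicalSpace.MetrizableSpace Y] [l.NeBot]
    (hF : TightAlong F l) {φ ψ : Y → EReal}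
    (hφ : LowerSemicontinuous φ) (hψ : LowerSemicontinuous ψ) :
    upperForm F l (φ ⊔ ψ) ≤ upperForm F l φ ⊔ upperForm F l ψ := by
  refine le_of_forall_le_pos_add fun ε hε => ?_
  have h1 : limsup (fun _ : ℕ => (ε : EReal)) l = ε := limsup_const _
  calc upperForm F l (φ ⊔ ψ)
      ≤ limsup ((fun _ : ℕ => (ε : EReal)) + fun n => extLsc (F n) φ ⊔ extLsc (F n) ψ) l :=
        limsup_le_limsup ((hF.subMax ε hε).mono fun n hn => extLsc_sup_le (hF.mem n) hn hφ hψ)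
    _ ≤ ε + limsup (fun n => extLsc (F n) φ ⊔ extLsc (F n) ψ) l := by
        refine (EReal.limsup_add_le ?_ ?_).trans_eq (by rw [h1]) <;> simp [h1]
    _ = ε + (upperForm F l φ ⊔ upperForm F l ψ) := by
        rw [upperForm, upperForm, ← limsup_max]

/-- The compactness principle: if, locally, `φ` has lower semicontinuous majorants on which the
upper limit is at most `M`, then it has a global one, thanks to tightness. -/
theorem TightAlong.exists_majorant [TopologicalSpace.MetrizableSpace Y] [l.NeBot]
    (hF : TightAlong F l) {φ : Y → EReal} {c M : ℝ} (hc : ∀ y, φ y ≤ c)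
    (h : ∀ y, ∃ ψ ∈ lscFun Y, upperForm F l ψ ≤ M ∧ ∀ᶠ z in 𝓝 y, φ z ≤ ψ z) :
    ∃ ψ ∈ lscFun Y, φ ≤ ψ ∧ upperForm F l ψ ≤ M := by
  -- Off `K`, the constant `c` majorizes `φ`, and `c + ind Kᶜ` has upper limit at most `M`.
  obtain ⟨K, hK, hKM⟩ := hF.tight (-c + M)
  obtain ⟨ψ, hψ, hψM, hψK⟩ : ∃ ψ ∈ lscFun Y, upperForm F l ψ ≤ M ∧ ∀ y ∈ K, φ y ≤ ψ y := by
    refine hK.induction_on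
      (p := fun s => ∃ ψ ∈ lscFun Y, upperForm F l ψ ≤ M ∧ ∀ y ∈ s, φ y ≤ ψ y) ?_ ?_ ?_ ?_
    · exact ⟨⊥, Cb_subset_lscFun (const_mem_Cb bot_ne_top), by simp [hF.upperForm_bot], by simp⟩
    · rintro s t hst ⟨ψ, h1, h2, h3⟩
      exact ⟨ψ, h1, h2, fun y hy => h3 y (hst hy)⟩
    · rintro s t ⟨ψ, h1, h2, h3⟩ ⟨θ, h4, h5, h6⟩
      refine ⟨ψ ⊔ θ, sup_mem_lscFun h1 h4, (hF.upperForm_sup_le h1.1 h4.1).trans (sup_le h2 h5), ?_⟩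
      rintro y (hy | hy)
      · exact (h3 y hy).trans le_sup_left
      · exact (h6 y hy).trans le_sup_right
    · intro y _
      obtain ⟨ψ, h1, h2, h3⟩ := h y
      exact ⟨_, mem_nhdsWithin_of_mem_nhds h3, ψ, h1, h2, fun z hz => hz⟩
  have hθ := coe_add_mem_lscFun c (ind_mem_lscFun hK.isClosed.isOpen_compl)
  refine ⟨ψ ⊔ fun y => (c : EReal) + ind Kᶜ y, sup_mem_lscFun hψ hθ, fun y => ?_,
    (hF.upperForm_sup_le hψ.1 hθ.1).trans (sup_le hψM ?_)⟩
  · by_cases hy : y ∈ K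
    · exact (hψK y hy).trans le_sup_left
    · refine (hc y).trans (le_trans ?_ le_sup_right)
      simp [ind_of_mem (show y ∈ Kᶜ from hy)]
  · refine (hF.upperForm_coe_add_le c _).trans ?_
    rw [coe_add_le_iff]
    exact_mod_cast hKM

end UpperForm
/-! ### Forms with a density -/

section Density

variable {Y : Type*}

theorem densityForm_mono (f : Y → EReal) : Monotone (densityForm f) :=
  fun _ _ h => iSup_mono fun y => EReal.sub_le_sub (h y) le_rfl

theorem le_densityForm (f φ : Y → EReal) (y : Y) : φ y - f y ≤ densityForm f φ :=
  le_iSup (fun y => φ y - f y) y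

theorem densityForm_subMax_zero (M : Set (Y → EReal)) (f : Y → EReal) :
    SubMax M (densityForm f) 0 := by
  intro φ _ ψ _
  rw [zero_add]
  refine iSup_le fun y => ?_
  rcases le_total (φ y) (ψ y) with h | h
  · rw [Pi.sup_apply, sup_eq_right.2 h]
    exact (le_densityForm f ψ y).trans le_sup_right
  · rw [Pi.sup_apply, sup_eq_left.2 h]
    exact (le_densityForm f φ y).trans le_sup_left

theorem densityForm_coe_add (f φ : Y → EReal) (c : ℝ) :
    densityForm f (fun y => (c : EReal) + φ y) = c + densityForm f φ := by
  apply le_antisymm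
  · refine iSup_le fun y => ?_
    rw [sub_eq_add_neg, add_assoc]
    exact add_le_add_right (le_densityForm f φ y) _
  · rw [coe_add_le_iff]
    refine iSup_le fun y => ?_
    rw [← coe_add_le_iff, sub_eq_add_neg, ← add_assoc]
    exact le_densityForm f (fun y => (c : EReal) + φ y) y

theorem rho_densityForm_le (M : Set (Y → EReal)) (f : Y → EReal) : rho M (densityForm f) ≤ 0 :=
  sInf_le ⟨EReal.zero_ne_top, densityForm_subMax_zero M f⟩

theorem rho_congr {M : Set (Y → EReal)} {F G : (Y → EReal) → EReal} (h : ∀ φ ∈ M, F φ = G φ)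
    (hM : ∀ φ ∈ M, ∀ ψ ∈ M, φ ⊔ ψ ∈ M) : rho M F = rho M G := by
  have : ∀ α, SubMax M F α ↔ SubMax M G α := fun α =>
    forall₂_congr fun φ hφ => forall₂_congr fun ψ hψ => by rw [h φ hφ, h ψ hψ, h _ (hM φ hφ ψ hψ)]
  simp only [rho, this]

variable [TopologicalSpace Y]

theorem densityForm_mem_LinForm {f : Y → EReal} {c : ℝ} (hf : ∀ y, (c : EReal) ≤ f y) :
    densityForm f ∈ LinForm (Cb Y) := by
  have hbot : ∀ y, f y ≠ ⊥ := fun y => ((EReal.bot_lt_coe c).trans_le (hf y)).ne'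
  refine ⟨⟨⟨(densityForm_mono f).monotoneOn _, fun d hd φ _ => ?_,
    0, EReal.zero_ne_top, densityForm_subMax_zero _ f⟩, ?_, ?_⟩, rho_densityForm_le _ f⟩
  · induction d with
    | top => exact absurd rfl hd
    | bot => simp [densityForm, sub_eq_add_neg]
    | coe d => exact densityForm_coe_add f φ d
  · intro φ ψ _ hψ hmon hlim
    have hle : ∀ n, φ n ≤ ψ := fun n y =>
      Monotone.ge_of_tendsto (f := fun n => φ n y) (fun m n h => hmon h y) (hlim y) n
    have h : ⨆ n, densityForm f (φ n) = densityForm f ψ := by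
      refine le_antisymm (iSup_le fun n => densityForm_mono f (hle n)) (iSup_le fun y => ?_)
      have hc : ContinuousAt (fun a : EReal => a - f y) (ψ y) :=
        (EReal.continuousAt_add (p := (ψ y, -f y)) (.inl ((Cb_subset_lscFun hψ).2 y))
          (.inr (by simpa using hbot y))).comp (f := fun a : EReal => (a, -f y)) (by fun_prop)
      exact le_of_tendsto (hc.tendsto.comp (hlim y)) (Eventually.of_forall fun n =>
        le_iSup_of_le n (le_densityForm f (φ n) y))
    rw [← h]
    exact tendsto_atTop_iSup fun m n hmn => densityForm_mono f (hmon hmn)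
  · rintro φ ⟨-, d, hd⟩
    have : densityForm f φ ≤ ((d - c : ℝ) : EReal) :=
      iSup_le fun y => by rw [EReal.coe_sub]; exact EReal.sub_le_sub (hd y) (hf y)
    exact (this.trans_lt (EReal.coe_lt_top _)).ne

/-- A lower semicontinuous density is determined by the form, since it can be tested on bumps. -/
theorem le_of_densityForm_le [TopologicalSpace.MetrizableSpace Y] {f f' : Y → EReal}
    (hf' : LowerSemicontinuous f') (h : ∀ φ ∈ Cb Y, densityForm f φ ≤ densityForm f' φ) :
    f' ≤ f := by
  intro y
  refine EReal.ge_of_forall_gt_iff_ge.1 fun a ha => ?_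
  obtain ⟨φ, hφ, hle, h0⟩ := exists_bump (hf'.isOpen_preimage (a : EReal)) (y := y) ha
  have h1 : densityForm f' φ ≤ ((-a : ℝ) : EReal) := by
    refine iSup_le fun z => ?_
    by_cases hz : z ∈ f' ⁻¹' Ioi (a : EReal)
    · rw [← zero_sub a, EReal.coe_sub]
      exact EReal.sub_le_sub ((hle z).trans (ind_le_zero _ z)) (mem_Ioi.1 hz).le
    · have := hle z
      rw [ind_of_notMem hz, le_bot_iff] at this
      simp [this, sub_eq_add_neg]
  have h2 := (le_densityForm f φ y).trans ((h φ hφ).trans h1)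
  rw [h0, zero_sub, EReal.coe_neg, EReal.neg_le_neg_iff] at h2
  exact h2

end Density

/-! ### Weak limits of tight sequences -/

section WeakLimit

variable {Y : Type*} [TopologicalSpace Y] [TopologicalSpace.MetrizableSpace Y]
  {F : ℕ → (Y → EReal) → EReal} {l : Filter ℕ}

/-- If the values of a tight sequence on the open sets of a basis converge, then the sequence
converges weakly. The density of the limit at `y` is minus the infimum of the limits of the values
of the open sets containing `y`. -/
theorem TightAlong.exists_density [l.NeBot] (hF : TightAlong F l) {B : Set (Set Y)}
    (hB : TopologicalSpace.IsTopologicalBasis B) {a : Set Y → EReal}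
    (ha : ∀ U ∈ B, Tendsto (fun n => extLsc (F n) (ind U)) l (𝓝 (a U))) :
    ∃ f : Y → EReal, LowerSemicontinuous f ∧ (∃ c : ℝ, ∀ y, (c : EReal) ≤ f y) ∧
      ∀ φ ∈ Cb Y, Tendsto (fun n => F n φ) l (𝓝 (densityForm f φ)) := by
  set f : Y → EReal := fun y => ⨆ U ∈ {U | U ∈ B ∧ y ∈ U}, -a U
  have hfU : ∀ U ∈ B, ∀ y ∈ U, -a U ≤ f y := fun U hU y hy =>
    le_iSup₂_of_le (f := fun U (_ : U ∈ {U | U ∈ B ∧ y ∈ U}) => -a U) U ⟨hU, hy⟩ le_rfl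
  have haU : ∀ U ∈ B, a U ≤ upperForm F l (ind univ) := fun U hU => by
    rw [← (ha U hU).limsup_eq]
    exact upperForm_mono (ind_le_of_zero_le fun y _ => by simp [ind_of_mem])
  have hBy : ∀ y, ∃ U ∈ B, y ∈ U := fun y => by
    obtain ⟨U, hU, hy, -⟩ := hB.exists_subset_of_mem_open (mem_univ y) isOpen_univ
    exact ⟨U, hU, hy⟩
  obtain ⟨C, hC⟩ := exists_real_ge_of_lt_top hF.bdd
  refine ⟨f, fun y t ht => ?_, ⟨-C, fun y => ?_⟩, fun φ hφ => ?_⟩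
  · obtain ⟨U, ⟨hU, hy⟩, htU⟩ := lt_biSup_iff.1 ht
    filter_upwards [(hB.isOpen hU).mem_nhds hy] with z hz
    exact htU.trans_le (hfU U hU z hz)
  · obtain ⟨U, hU, hy⟩ := hBy y
    rw [EReal.coe_neg]
    exact (EReal.neg_le_neg_iff.2 ((haU U hU).trans hC)).trans (hfU U hU y hy)
  have hφt : ∀ y, φ y ≠ ⊤ := (Cb_subset_lscFun hφ).2
  refine tendsto_of_le_liminf_of_limsup_le (iSup_le fun y => ?_) ?_
  · rcases eq_or_ne (φ y) ⊥ with h | h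
    · simp [h, sub_eq_add_neg]
    obtain ⟨r, hr⟩ := eq_coe_of_ne h (hφt y)
    rw [hr, sub_eq_add_neg]
    refine le_of_forall_coe_add_le fun c hc => ?_
    obtain ⟨U, hU, hy, hUφ⟩ := hB.exists_subset_of_mem_open
      (show y ∈ φ ⁻¹' Ioi (c : EReal) by simpa [hr] using hc) (isOpen_Ioi.preimage hφ.1)
    have h1 : Tendsto (fun n => (c : EReal) + extLsc (F n) (ind U)) l (𝓝 (c + a U)) :=
      ((continuous_coe_add c).tendsto _).comp (ha U hU)
    calc (c : EReal) + -f y ≤ c + a U :=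
          add_le_add_right (EReal.neg_le_of_neg_le (hfU U hU y hy)) _
      _ = liminf (fun n => (c : EReal) + extLsc (F n) (ind U)) l := h1.liminf_eq.symm
      _ ≤ liminf (fun n => F n φ) l := by
          refine liminf_le_liminf (Eventually.of_forall fun n => ?_)
          rw [← extLsc_of_mem_Cb (hF.mem n) hφ, coe_add_le_iff]
          refine (extLsc_mono (ind_le_of_zero_le fun z hz => ?_)).trans
            (extLsc_coe_add_le (hF.mem n) (-c) φ)
          rw [← coe_add_le_iff, add_zero]
          exact (hUφ hz).le
  · simp only [← fun n => extLsc_of_mem_Cb (hF.mem n) hφ]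
    refine EReal.le_of_forall_lt_iff_le.1 fun M hM => ?_
    obtain ⟨d, hd⟩ := hφ.2
    obtain ⟨ψ, -, hφψ, hψ⟩ := hF.exists_majorant (M := M) hd fun y => by
      obtain ⟨U, hU, hy, hUM⟩ : ∃ U ∈ B, y ∈ U ∧ φ y + a U < M := by
        rcases eq_or_ne (φ y) ⊥ with h | h
        · obtain ⟨U, hU, hy⟩ := hBy y
          exact ⟨U, hU, hy, by simp [h]⟩
        obtain ⟨r, hr⟩ := eq_coe_of_ne h (hφt y)
        have h1 := (le_densityForm f φ y).trans_lt hM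
        have h2 : (r : EReal) - M < f y := by
          rw [hr] at h1
          exact EReal.sub_lt_of_lt_add' (by
            rwa [EReal.sub_lt_iff (by simp) (by simp)] at h1)
        obtain ⟨U, ⟨hU, hy⟩, hUM⟩ := lt_biSup_iff.1 h2
        refine ⟨U, hU, hy, ?_⟩
        rw [hr]
        generalize a U = v at hUM ⊢
        induction v with
        | top => simp at hUM
        | bot => simp
        | coe u =>
          norm_cast at hUM ⊢
          linarith
      obtain ⟨c, hc, hcM⟩ := exists_coe_of_add_lt (hφt y).lt_top ((haU U hU).trans_lt hF.bdd) hUM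
      refine ⟨_, coe_add_mem_lscFun c (ind_mem_lscFun (hB.isOpen hU)), ?_, ?_⟩
      · refine (hF.upperForm_coe_add_le c _).trans (le_of_eq_of_le ?_ hcM)
        rw [upperForm, (ha U hU).limsup_eq]
      · filter_upwards [(hB.isOpen hU).mem_nhds hy, hφ.1.continuousAt.eventually_lt_const hc]
          with z hz hzc
        simpa [ind_of_mem hz] using hzc.le
    exact (upperForm_mono hφψ).trans hψ

/-- Along an ultrafilter, a tight sequence always converges weakly. -/
theorem TightAlong.exists_density_of_ultrafilter {𝒰 : Ultrafilter ℕ} (hF : TightAlong F 𝒰) :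
    ∃ f : Y → EReal, LowerSemicontinuous f ∧ (∃ c : ℝ, ∀ y, (c : EReal) ≤ f y) ∧
      ∀ φ ∈ Cb Y, Tendsto (fun n => F n φ) 𝒰 (𝓝 (densityForm f φ)) :=
  hF.exists_density TopologicalSpace.isTopologicalBasis_opens
    (a := fun U => (𝒰.map fun n => extLsc (F n) (ind U)).lim)
    fun U _ => (𝒰.map fun n => extLsc (F n) (ind U)).le_nhds_lim

/-- A countable basis gives countably many values, hence a convergent subsequence. -/
theorem TightAlong.exists_subseq_density [SecondCountableTopology Y] (hF : TightAlong F atTop) :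
    ∃ σ : ℕ → ℕ, StrictMono σ ∧ ∃ f : Y → EReal, (∃ c : ℝ, ∀ y, (c : EReal) ≤ f y) ∧
      ∀ φ ∈ Cb Y, Tendsto (fun n => F (σ n) φ) atTop (𝓝 (densityForm f φ)) := by
  have hB := TopologicalSpace.isBasis_countableBasis Y
  have : Countable (TopologicalSpace.countableBasis Y) :=
    (TopologicalSpace.countable_countableBasis Y).to_subtype
  obtain ⟨a, σ, hσ, ha⟩ := CompactSpace.tendsto_subseq
    (fun n (U : TopologicalSpace.countableBasis Y) => extLsc (F n) (ind (U : Set Y)))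
  rw [tendsto_pi_nhds] at ha
  have hle : map σ atTop ≤ atTop := hσ.tendsto_atTop
  obtain ⟨f, -, hc, hf⟩ := (hF.filter_mono hle).exists_density hB
    (a := fun U => limUnder (map σ atTop) fun n => extLsc (F n) (ind U)) fun U hU =>
      tendsto_nhds_limUnder ⟨a ⟨U, hU⟩, ha ⟨U, hU⟩⟩
  exact ⟨σ, hσ, f, hc, hf⟩

end WeakLimit
/-! ### Comparison with the dual conjugate -/

section Conjugate

variable {X Y : Type*} {b : X → Y → EReal} {g : X → EReal}

theorem sub_le_Bcirc (b : X → Y → EReal) (g : X → EReal) (x : X) (y : Y) :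
    b x y - g x ≤ Bcirc b g y :=
  le_iSup (fun x => b x y - g x) x

variable [TopologicalSpace Y] {F : ℕ → (Y → EReal) → EReal} {l : Filter ℕ} {f : Y → EReal}

/-- Near a point with `b x y - g x > -M`, the function `b x` is bounded below by a constant, and
comparing the characteristic function of a neighbourhood with `b x` gives the bound. -/
theorem TightAlong.exists_open_upperForm_le [l.NeBot] (hF : TightAlong F l)
    (hb : ∀ x, LowerSemicontinuous (b x)) (hbt : ∀ x y, b x y ≠ ⊤)
    (hg : ∀ x, upperForm F l (b x) ≤ g x) {y : Y} {M : ℝ} (h : -Bcirc b g y < M) :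
    ∃ U : Set Y, IsOpen U ∧ y ∈ U ∧ upperForm F l (ind U) ≤ M := by
  obtain ⟨x, hx⟩ := lt_iSup_iff.1 (EReal.neg_lt_comm.1 h)
  have hbx : b x y ≠ ⊥ := fun h => by simp [h, sub_eq_add_neg] at hx
  obtain ⟨r, hr⟩ := eq_coe_of_ne hbx (hbt x y)
  rw [hr] at hx
  obtain ⟨c, hc, hcM⟩ : ∃ c : ℝ, ((-r : ℝ) : EReal) < c ∧ (c : EReal) + g x ≤ M := by
    generalize g x = v at hx
    refine exists_coe_of_add_lt (EReal.coe_lt_top _) ?_ ?_ <;> induction v with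
    | top => simp [sub_eq_add_neg] at hx
    | bot => simp
    | coe v =>
      norm_cast at hx ⊢
      first
        | exact EReal.coe_lt_top v
        | linarith
  refine ⟨b x ⁻¹' Ioi ((-c : ℝ) : EReal), (hb x).isOpen_preimage _, ?_, ?_⟩
  · have : -r < c := by exact_mod_cast hc
    rw [mem_preimage, hr, mem_Ioi]
    exact_mod_cast (by linarith : -c < r)
  · calc upperForm F l (ind (b x ⁻¹' Ioi ((-c : ℝ) : EReal)))
        ≤ upperForm F l (fun y => (c : EReal) + b x y) := by
          refine upperForm_mono (ind_le_of_zero_le fun z hz => ?_)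
          rw [← neg_neg c, ← coe_add_le_iff, add_zero]
          exact (mem_Ioi.1 hz).le
      _ ≤ c + upperForm F l (b x) := hF.upperForm_coe_add_le c _
      _ ≤ M := (add_le_add_right (hg x) _).trans hcM

theorem TightAlong.limsup_setValue_le [TopologicalSpace.MetrizableSpace Y] [l.NeBot]
    (hF : TightAlong F l)
    (hb : ∀ x, LowerSemicontinuous (b x)) (hbt : ∀ x y, b x y ≠ ⊤)
    (hg : ∀ x, upperForm F l (b x) ≤ g x) {C : Set Y} (hC : IsClosed C) :
    limsup (fun n => setValue (F n) C) l ≤ densityForm (Bcirc b g) (ind C) := by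
  refine EReal.le_of_forall_lt_iff_le.1 fun M hM => ?_
  obtain ⟨ψ, hψ, hCψ, hψM⟩ := hF.exists_majorant (φ := ind C) (c := 0) (M := M)
    (fun y => by simpa using ind_le_zero C y) fun y => by
      by_cases hy : y ∈ C
      · have h1 := (le_densityForm (Bcirc b g) (ind C) y).trans_lt hM
        rw [ind_of_mem hy, zero_sub] at h1
        obtain ⟨U, hU, hyU, hUM⟩ := hF.exists_open_upperForm_le hb hbt hg h1
        refine ⟨ind U, ind_mem_lscFun hU, hUM, ?_⟩
        filter_upwards [hU.mem_nhds hyU] with z hz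
        rw [ind_of_mem hz]
        exact ind_le_zero C z
      · refine ⟨⊥, Cb_subset_lscFun (const_mem_Cb bot_ne_top), by simp [hF.upperForm_bot], ?_⟩
        filter_upwards [hC.isOpen_compl.mem_nhds hy] with z hz
        rw [ind_of_notMem hz]
        exact bot_le
  exact (limsup_le_limsup (Eventually.of_forall fun n => maxExt_le hψ hCψ)).trans hψM

/-- The value of a weak limit on a bump supported in `U` is at most the upper limit of the values
of `U`. -/
theorem neg_density_le_upperForm [TopologicalSpace.MetrizableSpace Y] [l.NeBot]
    (hf : ∀ φ ∈ Cb Y, Tendsto (fun n => F n φ) l (𝓝 (densityForm f φ))) {U : Set Y}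
    (hU : IsOpen U) {y : Y} (hy : y ∈ U) : -f y ≤ upperForm F l (ind U) := by
  obtain ⟨φ, hφ, hφU, h0⟩ := exists_bump hU hy
  calc -f y = φ y - f y := by rw [h0, zero_sub]
    _ ≤ densityForm f φ := le_densityForm f φ y
    _ = limsup (fun n => F n φ) l := (hf φ hφ).limsup_eq.symm
    _ ≤ upperForm F l (ind U) :=
        limsup_le_limsup (Eventually.of_forall fun n => le_extLsc hφ hφU)

theorem TightAlong.Bcirc_le_density [TopologicalSpace.MetrizableSpace Y] [l.NeBot]
    (hF : TightAlong F l)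
    (hb : ∀ x, LowerSemicontinuous (b x)) (hbt : ∀ x y, b x y ≠ ⊤)
    (hg : ∀ x, upperForm F l (b x) ≤ g x)
    (hf : ∀ φ ∈ Cb Y, Tendsto (fun n => F n φ) l (𝓝 (densityForm f φ))) : Bcirc b g ≤ f := by
  intro y
  rw [← EReal.neg_le_neg_iff]
  refine EReal.le_of_forall_lt_iff_le.1 fun M hM => ?_
  obtain ⟨U, hU, hy, hUM⟩ := hF.exists_open_upperForm_le hb hbt hg hM
  exact (neg_density_le_upperForm hf hU hy).trans hUM

theorem TightAlong.exists_lscFun_of_finite {ι : Type*} [TopologicalSpace.MetrizableSpace Y]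
    [l.NeBot] (hF : TightAlong F l) {W : Set ι} (hW : W.Finite) {ψ : ι → Y → EReal} {M : EReal}
    (hψ : ∀ z, ψ z ∈ lscFun Y) (hM : ∀ z ∈ W, upperForm F l (ψ z) ≤ M) :
    ∃ θ ∈ lscFun Y, upperForm F l θ ≤ M ∧ ∀ z ∈ W, ψ z ≤ θ := by
  induction W, hW using Set.Finite.induction_on with
  | empty =>
    exact ⟨⊥, Cb_subset_lscFun (const_mem_Cb bot_ne_top), by simp [hF.upperForm_bot], by simp⟩
  | @insert z s _ _ ih =>
    obtain ⟨θ, h1, h2, h3⟩ := ih fun w hw => hM w (mem_insert_of_mem z hw)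
    refine ⟨ψ z ⊔ θ, sup_mem_lscFun (hψ z) h1,
      (hF.upperForm_sup_le (hψ z).1 h1.1).trans (sup_le (hM z (mem_insert z s)) h2), ?_⟩
    rintro w (rfl | hw)
    · exact le_sup_left
    · exact (h3 w hw).trans le_sup_right

/-- At a point of `idom g`, the upper limit on the unbounded function `b x` is controlled by the
density of a weak limit. Upper coercivity provides finitely many `z` near `x` such that `b x` is
majorized by the supremum of a truncation `b x ⊓ M` and of the functions `b z - β`; the upper limit
on the latter is smaller than `g x` when `β` is large. -/
theorem TightAlong.le_iSup_sub [TopologicalSpace X] [TopologicalSpace.MetrizableSpace Y] [l.NeBot]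
    (hF : TightAlong F l)
    (hb : ∀ x, Continuous (b x)) (hbt : ∀ x y, b x y ≠ ⊤) (hup : UpperCoercive b)
    (hg : ∀ x, upperForm F l (b x) ≤ g x)
    (hf : ∀ φ ∈ Cb Y, Tendsto (fun n => F n φ) l (𝓝 (densityForm f φ)))
    {x : X} (hx : x ∈ idom g) (hgx : g x ≤ upperForm F l (b x)) : g x ≤ ⨆ y, (b x y - f y) := by
  obtain ⟨r, hr⟩ := eq_coe_of_ne (bot_lt_iff_ne_bot.1 hx.1.2) (lt_top_iff_ne_top.1 hx.1.1)
  obtain ⟨C, hC, -⟩ := EReal.lt_iff_exists_real_btwn.1 hx.2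
  obtain ⟨W, hW, hWV, hWM⟩ := hup x _ (eventually_lt_of_limsup_lt hC)
  -- With `β = C - r + 1`, the functions `b z - β`, `z ∈ W`, have upper limit at most `r - 1 < g x`.
  obtain ⟨M, hM⟩ := hWM (C - r + 1)
  have hlsc : ∀ z, b z ∈ lscFun Y := fun z => ⟨(hb z).lowerSemicontinuous, hbt z⟩
  obtain ⟨θ, hθ, hθr, hθW⟩ := hF.exists_lscFun_of_finite hW (M := ((r - 1 : ℝ) : EReal))
    (fun z => coe_add_mem_lscFun (-(C - r + 1)) (hlsc z)) fun z hz => by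
      refine (hF.upperForm_coe_add_le _ _).trans ?_
      refine (add_le_add_right ((hg z).trans (hWV hz).le) _).trans_eq ?_
      rw [← EReal.coe_add]
      congr 1
      ring
  have hmem : (fun _ => (M : EReal)) ⊓ b x ∈ Cb Y :=
    inf_mem_Cb (const_mem_Cb (EReal.coe_ne_top M)) (hb x)
  have hle : b x ≤ ((fun _ => (M : EReal)) ⊓ b x) ⊔ θ := by
    intro y
    by_cases hy : excess b x W y ≤ ((C - r + 1 : ℝ) : EReal)
    · exact (le_inf (hM y hy) le_rfl).trans le_sup_left
    · obtain ⟨z, hz, hlt⟩ := lt_biSup_iff.1 (not_le.1 hy)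
      refine le_trans ?_ ((hθW z hz y).trans le_sup_right)
      rw [← coe_add_le_iff]
      exact (EReal.add_lt_of_lt_sub hlt).le
  have h1 : g x ≤ upperForm F l ((fun _ => (M : EReal)) ⊓ b x) := by
    have h2 := hgx.trans ((upperForm_mono hle).trans
      (hF.upperForm_sup_le (Cb_subset_lscFun hmem).1 hθ.1))
    refine (le_sup_iff.1 h2).resolve_right fun h3 => ?_
    have h4 := h3.trans hθr
    rw [hr] at h4
    norm_cast at h4
    linarith
  refine h1.trans ?_
  have h2 : upperForm F l ((fun _ => (M : EReal)) ⊓ b x)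
      = densityForm f ((fun _ => (M : EReal)) ⊓ b x) := by
    rw [← (hf _ hmem).limsup_eq]
    simp only [upperForm, fun n => extLsc_of_mem_Cb (hF.mem n) hmem]
  rw [h2]
  exact densityForm_mono f inf_le_right

/-- If a lower semicontinuous `f ≥ B° g` satisfies `g x ≤ sup_y (b x y - f y)`, then the supremum is
attained by compactness, and at a maximizer `y` the functions `f` and `B° g` agree and `y` is a
subgradient of `g` at `x`. -/
theorem exists_subgradient [TopologicalSpace X]
    (hb : ∀ x, Continuous (b x)) (hbt : ∀ x y, b x y ≠ ⊤)
    (hY : DiscreteTopology Y ∨ ∀ y, ⊥ < Bcirc b g y)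
    (hcomp : Bcirc b g ∈ classFc b ∨ Coercive b)
    (hf : LowerSemicontinuous f) (hBf : Bcirc b g ≤ f) {x : X} (hx : x ∈ idom g)
    (hgx : g x ≤ ⨆ y, (b x y - f y)) :
    ∃ y ∈ dom (Bcirc b g), x ∈ invSubdiffCirc b g y ∧ f y = Bcirc b g y := by
  obtain ⟨r, hr⟩ := eq_coe_of_ne (bot_lt_iff_ne_bot.1 hx.1.2) (lt_top_iff_ne_top.1 hx.1.1)
  have hle : ∀ z y, b z y - f y ≤ g z := fun z y =>
    (EReal.sub_le_sub le_rfl (hBf y)).trans (sub_le_of_sub_le (sub_le_Bcirc b g z y))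
  -- Where `b x - f` is bounded below, both `b x` and `f` are finite, because `b x - f ≤ g x < ⊤`.
  have hreal : ∀ (t : ℝ) (y : Y), (t : EReal) ≤ b x y - f y →
      ∃ p q : ℝ, b x y = p ∧ f y = q ∧ t ≤ p - q := by
    intro t y hty
    have h1 : b x y - f y ≤ r := hr ▸ hle x y
    have h2 : b x y ≠ ⊥ := fun h => by simp [h, sub_eq_add_neg] at hty
    obtain ⟨p, hp⟩ := eq_coe_of_ne h2 (hbt x y)
    rw [hp] at h1 hty
    have h3 : f y ≠ ⊥ := fun h => by simp [h, sub_eq_add_neg] at h1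
    have h4 : f y ≠ ⊤ := fun h => by simp [h, sub_eq_add_neg] at hty
    obtain ⟨q, hq⟩ := eq_coe_of_ne h3 h4
    rw [hq] at hty
    exact ⟨p, q, hp, hq, by exact_mod_cast hty⟩
  -- Outside the discrete case, `f ≥ B° g > ⊥` excludes the indeterminate sum `⊥ + ⊤`.
  have husc : UpperSemicontinuous fun y => b x y - f y := by
    rcases hY with hY | hY
    · exact continuous_of_discreteTopology.upperSemicontinuous
    · refine (hb x).upperSemicontinuous.add' (g := fun y => -f y)
        (continuous_neg.comp_lowerSemicontinuous_antitone hf fun _ _ h =>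
          EReal.neg_le_neg_iff.2 h) fun y => ?_
      refine EReal.continuousAt_add (.inl (hbt x y)) (.inr ?_)
      simpa using ((hY y).trans_le (hBf y)).ne'
  set S : Set Y := {y | ((r - 1 : ℝ) : EReal) ≤ b x y - f y}
  have hSclosed : IsClosed S := husc.isClosed_preimage _
  have hScompact : IsCompact S := by
    rcases hcomp with h | h
    · exact (h.2 x (r - 1)).of_isClosed_subset hSclosed (subset_closure.trans' fun y hy =>
        le_trans hy (EReal.sub_le_sub le_rfl (hBf y)))
    · obtain ⟨C, hC, -⟩ := EReal.lt_iff_exists_real_btwn.1 hx.2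
      refine (h x _ (eventually_lt_of_limsup_lt hC) (C - (r - 1))).of_isClosed_subset hSclosed
        (subset_closure.trans' fun y hy =>
          show excess b x _ y ≤ _ from iSup₂_le fun z hz => ?_)
      obtain ⟨p, q, hp, hq, hpq⟩ := hreal _ y hy
      have h1 := (hle z y).trans (le_of_lt hz)
      rw [hq, EReal.sub_le_iff_le_add (by simp) (by simp)] at h1
      rw [hp, EReal.sub_le_iff_le_add (by simp) (by simp)]
      refine h1.trans ?_
      norm_cast
      linarith
  have hlt : ((r - 1 : ℝ) : EReal) < ⨆ y, (b x y - f y) :=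
    lt_of_lt_of_le (by rw [hr]; exact_mod_cast sub_one_lt r) hgx
  obtain ⟨y₀, hy₀⟩ := lt_iSup_iff.1 hlt
  obtain ⟨y, hy, hmax⟩ :=
    UpperSemicontinuousOn.exists_isMaxOn ⟨y₀, hy₀.le⟩ hScompact (husc.upperSemicontinuousOn S)
  have hry : (r : EReal) ≤ b x y - f y := by
    rw [← hr]
    refine hgx.trans (iSup_le fun z => ?_)
    by_cases hz : z ∈ S
    · exact hmax hz
    · exact (not_le.1 hz).le.trans hy
  obtain ⟨p, q, hp, hq, hpq⟩ := hreal _ y hry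
  have hfB : f y ≤ Bcirc b g y := by
    refine le_trans ?_ (sub_le_Bcirc b g x y)
    rw [hp, hq, hr]
    exact_mod_cast (by linarith : q ≤ p - r)
  have heq : f y = Bcirc b g y := le_antisymm hfB (hBf y)
  refine ⟨y, ⟨?_, ?_⟩, ⟨⟨by simp [hp], by simp [hp]⟩, fun z => ?_⟩, heq⟩
  · simp [lowerDom, ← heq, hq]
  · simp [upperDom, ← heq, hq]
  · refine (sub_le_Bcirc b g z y).trans ?_
    rw [← heq, hp, hq, hr]
    exact_mod_cast (by linarith : q ≤ p - r)

/-- The contact set of `f` and `B° g` contains the algebraically essential points, since these are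
the only subgradients at some `x`. It is dense around the topologically essential points; this is
enough by quasi-continuity of `B° g` and lower semicontinuity of `f`. -/
theorem eq_Bcirc_on_essentialSet [TopologicalSpace X] (hf : LowerSemicontinuous f)
    (hBf : Bcirc b g ≤ f) (hqc : QuasiContinuousOnDom (Bcirc b g))
    (hsub : ∀ x ∈ idom g, ∃ y ∈ dom (Bcirc b g), x ∈ invSubdiffCirc b g y ∧ f y = Bcirc b g y)
    {y : Y} (hy : y ∈ essentialSet b g (idom g)) : f y = Bcirc b g y := by
  rcases hy with ⟨-, hy⟩ | ⟨hyd, V, hV, hyV, hVt⟩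
  · obtain ⟨x, hx, hxy⟩ := not_subset.1 hy
    obtain ⟨z, hz, hxz, hfz⟩ := hsub x hx.1
    by_cases hzy : z = y
    · exact hzy ▸ hfz
    · exact absurd (mem_biUnion (show z ∈ lowerDom (Bcirc b g) \ {y} from ⟨hz.1, hzy⟩) hxz) hxy
  refine le_antisymm ?_ (hBf y)
  by_contra! hlt
  obtain ⟨a, ha, ha'⟩ := EReal.lt_iff_exists_real_btwn.1 hlt
  -- Quasi-continuity yields a relatively open set near `y` on which `B° g < a < f y`; a contact
  -- point `z` in it and close to `y` contradicts `f z > a`.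
  have h1 := hqc (Iio (a : EReal)) isOpen_Iio (show (⟨y, hyd⟩ : dom (Bcirc b g)) ∈ _ from ha)
  obtain ⟨w, hwO, hwi⟩ := mem_closure_iff.1 h1
    (Subtype.val ⁻¹' (V ∩ f ⁻¹' Ioi (a : EReal)))
    ((hV.inter (hf.isOpen_preimage _)).preimage continuous_subtype_val) ⟨hyV, ha'⟩
  obtain ⟨O, hO, hOeq⟩ := isOpen_induced_iff.1
    (isOpen_interior (s := (fun z : dom (Bcirc b g) => Bcirc b g z) ⁻¹' Iio (a : EReal)))
  have hwO' : (w : Y) ∈ O := by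
    rw [← hOeq] at hwi
    exact hwi
  obtain ⟨x, hx, hxU⟩ := not_subset.1 ((hVt ⟨hwO.1, w.2⟩).2
    (O ∩ f ⁻¹' Ioi (a : EReal)) (hO.inter (hf.isOpen_preimage _)) ⟨hwO', hwO.2⟩)
  obtain ⟨z, hz, hxz, hfz⟩ := hsub x hx.1
  by_cases hzU : z ∈ O ∩ f ⁻¹' Ioi (a : EReal)
  · have h2 : (⟨z, hz⟩ : dom (Bcirc b g)) ∈
        interior ((fun z : dom (Bcirc b g) => Bcirc b g z) ⁻¹' Iio (a : EReal)) := by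
      rw [← hOeq]
      exact hzU.1
    have h3 : (⟨z, hz⟩ : dom (Bcirc b g)) ∈ _ ⁻¹' Iio (a : EReal) := interior_subset h2
    have h3 : Bcirc b g z < a := h3
    exact absurd (hfz ▸ h3) (not_lt.2 (mem_Ioi.1 hzU.2).le)
  · exact hxU (mem_biUnion (show z ∈ lowerDom (Bcirc b g) \ _ from ⟨hz.1, hzU⟩) hxz)

end Conjugate
/-! ### Accumulation points of the sequence -/

section AccumulationPoints

variable {X Y : Type*} [TopologicalSpace Y]
  {F : ℕ → (Y → EReal) → EReal} {F' : (Y → EReal) → EReal} {f : Y → EReal}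

theorem tightAlong_atTop [T2Space Y] (hF : ∀ n, F n ∈ QL (Cb Y)) (htight : AsymptoticallyTight F)
    (hbdd : limsup (fun n => setValue (F n) univ) atTop < ⊤)
    (hrho : Tendsto (fun n => rho (Cb Y) (F n)) atTop (𝓝 0)) : TightAlong F atTop where
  mem := hF
  subMax ε hε := by
    filter_upwards [hrho.eventually_lt_const (show (0 : EReal) < ε by exact_mod_cast hε)] with n hn
    obtain ⟨α, ⟨-, hα⟩, hαε⟩ := sInf_lt_iff.1 hn
    exact hα.mono hαε.le
  tight M := by
    have h := htight.2 ▸ EReal.bot_lt_coe M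
    obtain ⟨K, hK'⟩ := iInf_lt_iff.1 h
    obtain ⟨hK, hKM⟩ := iInf_lt_iff.1 hK'
    refine ⟨K, hK, le_of_eq_of_le ?_ hKM.le⟩
    simp only [setValue, maxExt_of_mem_lscFun
      (ind_mem_lscFun (IsCompact.isClosed (show IsCompact K from hK)).isOpen_compl), upperForm]
  bdd := by
    simpa only [setValue, maxExt_of_mem_lscFun (ind_mem_lscFun (isOpen_univ (X := Y))),
      upperForm] using hbdd

theorem mem_LinForm_of_eq_densityForm (hF' : F' ∈ QL (Cb Y))
    (h : ∀ φ ∈ Cb Y, F' φ = densityForm f φ) : F' ∈ LinForm (Cb Y) :=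
  ⟨hF', (rho_congr h fun _ h1 _ h2 => sup_mem_Cb h1 h2).trans_le (rho_densityForm_le _ f)⟩

variable [TopologicalSpace.MetrizableSpace Y]

/-- An accumulation point is the limit along an ultrafilter, so it has a density. -/
theorem TightAlong.exists_density_of_isWeakAccPt (hF : TightAlong F atTop)
    (hF' : IsWeakAccPt F F') :
    ∃ 𝒰 : Ultrafilter ℕ, (𝒰 : Filter ℕ) ≤ atTop ∧ ∃ f : Y → EReal, LowerSemicontinuous f ∧
      (∀ φ ∈ Cb Y, F' φ = densityForm f φ) ∧
      ∀ φ ∈ Cb Y, Tendsto (fun n => F n φ) 𝒰 (𝓝 (F' φ)) := by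
  obtain ⟨𝒰, h𝒰, hlim⟩ := mapClusterPt_iff_ultrafilter.1 hF'.2
  rw [tendsto_pi_nhds] at hlim
  obtain ⟨f, h1, -, h3⟩ := (hF.filter_mono h𝒰).exists_density_of_ultrafilter
  exact ⟨𝒰, h𝒰, f, h1,
    fun φ hφ => tendsto_nhds_unique (hlim ⟨φ, hφ⟩) (h3 φ hφ), fun φ hφ => hlim ⟨φ, hφ⟩⟩

theorem IsLscDensity.unique {f₁ f₂ : Y → EReal} (h₁ : IsLscDensity f₁ F')
    (h₂ : IsLscDensity f₂ F') : f₁ = f₂ :=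
  le_antisymm
    (le_of_densityForm_le h₁.1 fun φ hφ => (h₂.2 φ hφ ▸ h₁.2 φ hφ).le)
    (le_of_densityForm_le h₂.1 fun φ hφ => (h₁.2 φ hφ ▸ h₂.2 φ hφ).le)

end AccumulationPoints

end MaxPlus

theorem mainTheorem2 {X Y : Type*} [TopologicalSpace X] [T2Space X]
    [TopologicalSpace Y] [PolishSpace Y]
    (b : X → Y → EReal) (hb : IsKernel b)
    (F : ℕ → (Y → EReal) → EReal) (hF : ∀ n, F n ∈ QL (Cb Y))
    (htight : AsymptoticallyTight F)
    (hbdd : limsup (fun n => setValue (F n) Set.univ) atTop < ⊤)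
    (hrho : Tendsto (fun n => rho (Cb Y) (F n)) atTop (𝓝 0))
    (g : X → EReal) (hg : ∀ x, g x = limsup (fun n => maxExt (F n) (b x)) atTop)
    (hA : TechnicalAssumption b g) :
    -- (i)
    (∃ F' ∈ LinForm (Cb Y), ∃ σ : ℕ → ℕ, StrictMono σ ∧
      WeaklyConverges (fun n => F (σ n)) F') ∧
    -- (ii)
    IsCovering (invSubdiffCirc b g) (lowerDom (Bcirc b g)) (idom g) ∧
    -- (iii)
    (∀ F', IsWeakAccPt F F' →
      F' ∈ LinForm (Cb Y) ∧ (∃! f, IsLscDensity f F') ∧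
        ∀ f, IsLscDensity f F' → Bcirc b g ≤ f) ∧
    (∀ C : Set Y, IsClosed C →
      limsup (fun n => setValue (F n) C) atTop ≤ densityForm (Bcirc b g) (ind C)) ∧
    ((∀ x, Tendsto (fun n => maxExt (F n) (b x)) atTop (𝓝 (g x))) →
      -- (iv)
      (∀ F', IsWeakAccPt F F' → ∀ f, IsLscDensity f F' →
        ∀ y ∈ essentialSet b g (idom g), f y = Bcirc b g y) ∧
      (∀ G : Set Y, IsOpen G →
        densityForm (Bcirc b g) (ind (G ∩ essentialSet b g (idom g))) ≤
          liminf (fun n => setValue (F n) G) atTop) ∧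
      -- (v)
      (IsTopMinimalCovering (invSubdiffCirc b g) (lowerDom (Bcirc b g)) (idom g) →
        densityForm (Bcirc b g) ∈ LinForm (Cb Y) ∧
          WeaklyConverges F (densityForm (Bcirc b g)))) := by
  have hT := tightAlong_atTop hF htight hbdd hrho
  -- In both alternatives of the first technical assumption, `b` is continuous in `y`.
  have hbc : ∀ x, Continuous (b x) := fun x => by
    rcases hA.discrete_or_continuous with h | h
    · exact continuous_of_discreteTopology
    · exact h.1 x
  have hYd : DiscreteTopology Y ∨ ∀ y, ⊥ < Bcirc b g y :=
    hA.discrete_or_continuous.imp_right And.right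
  have hbm : ∀ n x, maxExt (F n) (b x) = extLsc (F n) (b x) := fun n x =>
    maxExt_of_mem_lscFun ⟨hb.lsc x, hb.ne_top x⟩
  simp only [hbm] at hg ⊢
  have hgU : ∀ {l : Filter ℕ}, l ≤ atTop → ∀ x, upperForm F l (b x) ≤ g x := fun hl x =>
    (upperForm_filter_mono hl _).trans_eq (hg x).symm
  -- A density of an ultrafilter limit majorizes `B° g`.
  have hBle : ∀ {𝒰 : Ultrafilter ℕ} {f : Y → EReal}, (𝒰 : Filter ℕ) ≤ atTop →
      (∀ φ ∈ Cb Y, Tendsto (fun n => F n φ) 𝒰 (𝓝 (densityForm f φ))) → Bcirc b g ≤ f :=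
    fun h𝒰 hf => (hT.filter_mono h𝒰).Bcirc_le_density hb.lsc hb.ne_top (hgU h𝒰) hf
  have hsub : ∀ {𝒰 : Ultrafilter ℕ} {f : Y → EReal}, (𝒰 : Filter ℕ) ≤ atTop →
      LowerSemicontinuous f → (∀ φ ∈ Cb Y, Tendsto (fun n => F n φ) 𝒰 (𝓝 (densityForm f φ))) →
      ∀ x ∈ idom g, g x ≤ upperForm F 𝒰 (b x) →
      ∃ y ∈ dom (Bcirc b g), x ∈ invSubdiffCirc b g y ∧ f y = Bcirc b g y :=
    fun h𝒰 hlsc hf x hx hgx =>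
      exists_subgradient hbc hb.ne_top hYd hA.compactness hlsc (hBle h𝒰 hf) hx
        ((hT.filter_mono h𝒰).le_iSup_sub hbc hb.ne_top hA.upperCoercive (hgU h𝒰) hf hx hgx)
  refine ⟨?_, ?_, ?_, ?_, fun hlim => ?_⟩
  · obtain ⟨σ, hσ, f, ⟨c, hc⟩, hf⟩ := hT.exists_subseq_density
    exact ⟨densityForm f, densityForm_mem_LinForm hc, σ, hσ, hf⟩
  · intro x hx
    -- The upper limit defining `g x` is a limit along some ultrafilter.
    obtain ⟨𝒰, h𝒰, hx𝒰⟩ := mapClusterPt_iff_ultrafilter.1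
      (MapClusterPt.limsup (f := atTop) (u := fun n => extLsc (F n) (b x)))
    obtain ⟨f, hlsc, -, hf⟩ := (hT.filter_mono h𝒰).exists_density_of_ultrafilter
    obtain ⟨y, hy, hxy, -⟩ := hsub h𝒰 hlsc hf x hx ((hg x).trans hx𝒰.limsup_eq.symm).le
    exact mem_biUnion hy.1 hxy
  · intro F' hF'
    obtain ⟨𝒰, h𝒰, f, hlsc, heq, hf⟩ := hT.exists_density_of_isWeakAccPt hF'
    refine ⟨mem_LinForm_of_eq_densityForm hF'.1 heq, ⟨f, ⟨hlsc, heq⟩, fun f' hf' =>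
      hf'.unique ⟨hlsc, heq⟩⟩, fun f' hf' => hBle h𝒰 fun φ hφ => hf'.2 φ hφ ▸ hf φ hφ⟩
  · intro C hC
    exact hT.limsup_setValue_le hb.lsc hb.ne_top (hgU le_rfl) hC
  -- When `g` is a limit, it is the limit along every ultrafilter, whence contact everywhere on `Z`.
  have hess : ∀ {𝒰 : Ultrafilter ℕ} {f : Y → EReal}, (𝒰 : Filter ℕ) ≤ atTop →
      LowerSemicontinuous f → (∀ φ ∈ Cb Y, Tendsto (fun n => F n φ) 𝒰 (𝓝 (densityForm f φ))) →
      ∀ y ∈ essentialSet b g (idom g), f y = Bcirc b g y :=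
    fun h𝒰 hlsc hf y hy => eq_Bcirc_on_essentialSet hlsc (hBle h𝒰 hf) hA.quasiContinuous
      (fun x hx => hsub h𝒰 hlsc hf x hx ((hlim x).mono_left h𝒰).limsup_eq.ge) hy
  refine ⟨fun F' hF' f' hf' y hy => ?_, fun G hG => iSup_le fun y => ?_, fun hmin => ?_⟩
  · obtain ⟨𝒰, h𝒰, f, hlsc, heq, hf⟩ := hT.exists_density_of_isWeakAccPt hF'
    exact hess h𝒰 hf'.1 (fun φ hφ => hf'.2 φ hφ ▸ hf φ hφ) y hy
  · by_cases hy : y ∈ G ∩ essentialSet b g (idom g)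
    · -- The lower limit on `G` is the limit along some ultrafilter.
      obtain ⟨𝒰, h𝒰, hG𝒰⟩ := mapClusterPt_iff_ultrafilter.1
        (MapClusterPt.liminf (f := atTop) (u := fun n => setValue (F n) G))
      obtain ⟨f, hlsc, -, hf⟩ := (hT.filter_mono h𝒰).exists_density_of_ultrafilter
      rw [ind_of_mem hy, zero_sub, ← hess h𝒰 hlsc hf y hy.2, ← hG𝒰.limsup_eq]
      simpa only [setValue, maxExt_of_mem_lscFun (ind_mem_lscFun hG), upperForm] using
        neg_density_le_upperForm hf hG hy.1
    · simp [ind_of_notMem hy, sub_eq_add_neg]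
  · -- Where `B° g` is infinite, either `B° g = ⊤ ≤ f`, or `Y` is discrete and topologically
    -- essential points are algebraically essential.
    have hfB : ∀ {𝒰 : Ultrafilter ℕ} {f : Y → EReal}, (𝒰 : Filter ℕ) ≤ atTop →
        LowerSemicontinuous f → (∀ φ ∈ Cb Y, Tendsto (fun n => F n φ) 𝒰 (𝓝 (densityForm f φ))) →
        f = Bcirc b g := by
      intro 𝒰 f h𝒰 hlsc hf
      have hid : idom g ∩ upperDom g = idom g := inter_eq_left.2 fun x hx => hx.1.2
      funext y
      by_cases hyt : Bcirc b g y < ⊤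
      · refine hess h𝒰 hlsc hf y ?_
        unfold essentialSet
        rw [hid]
        by_cases hyb : ⊥ < Bcirc b g y
        · exact .inr ⟨⟨hyt, hyb⟩, univ, isOpen_univ, mem_univ y, fun z hz => hmin.2 z hz.2.1⟩
        · have : DiscreteTopology Y := hYd.resolve_right fun h => hyb (h y)
          exact .inl ⟨hyt, (hmin.2 y hyt).2 {y} (isOpen_discrete _) rfl⟩
      · have h := hBle h𝒰 hf y
        rw [not_lt_top_iff.1 hyt] at h ⊢
        exact top_le_iff.1 h
    refine ⟨?_, fun φ hφ => tendsto_iff_ultrafilter _ _ _ |>.2 fun 𝒰 h𝒰 => ?_⟩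
    · have h𝒰 := Ultrafilter.of_le (atTop : Filter ℕ)
      obtain ⟨f, hlsc, ⟨c, hc⟩, hf⟩ := (hT.filter_mono h𝒰).exists_density_of_ultrafilter
      exact hfB h𝒰 hlsc hf ▸ densityForm_mem_LinForm hc
    · obtain ⟨f, hlsc, -, hf⟩ := (hT.filter_mono h𝒰).exists_density_of_ultrafilter
      exact hfB h𝒰 hlsc hf ▸ hf φ hφ
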